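/- Let $H$ be a separable complex Hilbert space (of finite or countably infinite dimension), let $B(H)$ be the algebra of bounded linear operators on $H$, and let $B_{sk}(H)=\{a\in B(H): a^*=-a\}$, regarded as a real Lie algebra with bracket $[a,b]=ab-ba$. A linear map $D:B_{sk}(H)\to B_{sk}(H)$ is an \emph{inner derivation} if there is $a\in B_{sk}(H)$ with $D(x)=[a,x]$ for all $x\in B_{sk}(H)$. An $\mathbb{R}$-linear map $\nabla:B_{sk}(H)\to B_{sk}(H)$ is a \emph{local inner derivation} if for every $x\in B_{sk}(H)$ there is an inner derivation $D$, possibly depending on $x$, with $\nabla(x)=D(x)$. The \emph{ultraweak topology} on $B_{sk}(H)$ is the restriction of the coarsest topology on $B(H)$ making all functionals $a\mapsto\sum_{n}\langle a\xi_n,\eta_n\rangle$ continuous, where $(\xi_n)$, $(\eta_n)$ are sequences in $H$ with $\sum_n\|\xi_n\|^2<\infty$ and $\sum_n\|\eta_n\|^2<\infty$. Then every local inner derivation $\nabla$ on $B_{sk}(H)$ that is continuous from the ultraweak topology to the ultraweak topology is an inner derivation: there is $a\in B_{sk}(H)$ such that $\nabla(x)=[a,x]$ for all $x\in B_{sk}(H)$.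 -/

import Mathlib

open scoped Topology

attribute [local instance] LieRing.ofAssociativeRing

section InnerDerivations

variable {R L : Type*} [CommRing R] [LieRing L] [LieAlgebra R L]

/-- A linear map `D` on a Lie algebra `L` is an inner derivation if `D x = ⁅a, x⁆` for some
fixed `a` in `L` and all `x`. -/
def IsInnerDerivation (D : L →ₗ[R] L) : Prop :=
  ∃ a : L, ∀ x : L, D x = ⁅a, x⁆

/-- A linear map `D` on a Lie algebra `L` is a local inner derivation if at every point `x` it
agrees with some inner derivation of `L`, which may depend on `x`. -/
def IsLocalInnerDerivation (D : L →ₗ[R] L) : Prop :=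
  ∀ x : L, ∃ E : L →ₗ[R] L, IsInnerDerivation E ∧ D x = E x

end InnerDerivations

noncomputable section SkewAdjointOperators

variable (H : Type*) [NormedAddCommGroup H] [InnerProductSpace ℂ H] [CompleteSpace H]

/-- The real Lie algebra of bounded operators `a` on `H` with `a* = -a`, with bracket
`⁅a, b⁆ = a * b - b * a`. -/
def skewAdjointOperators : LieSubalgebra ℝ (H →L[ℂ] H) where
  carrier := {a | star a = -a}
  add_mem' {a b} ha hb := by
    simp only [Set.mem_ofPred_eq] at ha hb ⊢
    rw [star_add, ha, hb, neg_add]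
  zero_mem' := by simp
  smul_mem' c a ha := by
    simp only [Set.mem_ofPred_eq] at ha ⊢
    rw [star_smul, ha, star_trivial, smul_neg]
  lie_mem' {a b} ha hb := by
    simp only [Set.mem_ofPred_eq, LieRing.of_associative_ring_bracket] at ha hb ⊢
    change star a = -a at ha
    change star b = -b at hb
    change star (a * b - b * a) = -(a * b - b * a)
    rw [star_sub, star_mul, star_mul, ha, hb]
    noncomm_ring

variable {H}

/-- The functional `a ↦ ∑ₙ ⟪y n, a (x n)⟫` on bounded operators. -/
def vectorSeriesFunctional (x y : ℕ → H) (a : H →L[ℂ] H) : ℂ :=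
  ∑' n, inner ℂ (y n) (a (x n))

/-- The series defining `vectorSeriesFunctional` converges absolutely for square-summable
sequences of vectors. -/
theorem summable_vectorSeries {H : Type*} [NormedAddCommGroup H] [InnerProductSpace ℂ H]
    {x y : ℕ → H} (hx : Summable fun n => ‖x n‖ ^ 2)
    (hy : Summable fun n => ‖y n‖ ^ 2) (a : H →L[ℂ] H) :
    Summable fun n => ‖inner ℂ (y n) (a (x n))‖ := by
  refine Summable.of_nonneg_of_le (fun n => norm_nonneg _) (fun n => ?_)
    ((hx.add hy).mul_left ‖a‖)
  have h1 : ‖inner ℂ (y n) (a (x n))‖ ≤ ‖y n‖ * (‖a‖ * ‖x n‖) :=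
    (norm_inner_le_norm _ _).trans
      (mul_le_mul_of_nonneg_left (a.le_opNorm _) (norm_nonneg _))
  have h2 : ‖y n‖ * ‖x n‖ ≤ ‖x n‖ ^ 2 + ‖y n‖ ^ 2 := by
    nlinarith [sq_nonneg (‖x n‖ - ‖y n‖), sq_nonneg ‖x n‖, sq_nonneg ‖y n‖]
  calc ‖inner ℂ (y n) (a (x n))‖ ≤ ‖a‖ * (‖y n‖ * ‖x n‖) := by linarith
    _ ≤ ‖a‖ * (‖x n‖ ^ 2 + ‖y n‖ ^ 2) := mul_le_mul_of_nonneg_left h2 (norm_nonneg _)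

variable (H)

/-- The ultraweak (σ-weak) topology on the bounded operators on `H`: the coarsest topology making
all functionals `a ↦ ∑ₙ ⟪y n, a (x n)⟫` continuous, where `∑ₙ ‖x n‖² < ∞` and
`∑ₙ ‖y n‖² < ∞`. -/
abbrev ultraweakTopology : TopologicalSpace (H →L[ℂ] H) :=
  ⨅ (x : ℕ → H) (y : ℕ → H) (_ : Summable fun n => ‖x n‖ ^ 2) (_ : Summable fun n => ‖y n‖ ^ 2),
    TopologicalSpace.induced (vectorSeriesFunctional x y) inferInstance

/-- The ultraweak topology on the skew-adjoint operators, as a subspace of all bounded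
operators. -/
abbrev skewUltraweakTopology : TopologicalSpace (skewAdjointOperators H) :=
  TopologicalSpace.induced Subtype.val (ultraweakTopology H)

end SkewAdjointOperators

/-! Extend `D` complex-linearly to all bounded operators. At a projection `p` the extension is a
commutator `[b, p]`, so it satisfies the Leibniz rule for `p * p = p`. Polarizing over sums of
orthogonal projections makes the Jordan defect vanish on all pairs of rank-one operators
(`jordanDefect_rankOne`). After subtracting a commutator to kill one rank-one projection, this
forces the extension to be a commutator with a skew-adjoint `a` on rank-one operators
(`exists_skew_forall_rankOne`), where boundedness of `a` is Hellinger–Toeplitz. Finite-rank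
compressions of `T` converge ultraweakly to `T`, so continuity gives `D T = ⁅a, T⁆`. -/

noncomputable section

open InnerProductSpace ContinuousLinearMap

/-! ### Polarizing the Jordan identity -/

section JordanDefect

variable {A : Type*} [Ring A] [Algebra ℂ A]

/-- The bilinear map measuring the failure of a linear map to be a Jordan derivation. -/
def jordanDefect (Δ : A →ₗ[ℂ] A) : A →ₗ[ℂ] A →ₗ[ℂ] A :=
  LinearMap.mk₂ ℂ (fun x y => Δ (x * y + y * x) - (Δ x * y + x * Δ y + Δ y * x + y * Δ x))
    (fun x x' y => by simp only [add_mul, mul_add, map_add]; abel)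
    (fun c x y => by
      simp only [smul_mul_assoc, mul_smul_comm, map_add, map_smul, smul_sub, smul_add])
    (fun x y y' => by simp only [add_mul, mul_add, map_add]; abel)
    (fun c x y => by
      simp only [smul_mul_assoc, mul_smul_comm, map_add, map_smul, smul_sub, smul_add])

theorem jordanDefect_apply (Δ : A →ₗ[ℂ] A) (x y : A) :
    jordanDefect Δ x y = Δ (x * y + y * x) - (Δ x * y + x * Δ y + Δ y * x + y * Δ x) := rfl

theorem jordanDefect_comm (Δ : A →ₗ[ℂ] A) (x y : A) :
    jordanDefect Δ x y = jordanDefect Δ y x := by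
  rw [jordanDefect_apply, jordanDefect_apply, add_comm (x * y)]
  abel

theorem eq_zero_of_add_self_eq_zero {M : Type*} [AddCommGroup M] [Module ℂ M] {x : M}
    (h : x + x = 0) : x = 0 := by
  rw [← two_smul ℂ x] at h
  exact (smul_eq_zero.mp h).resolve_left two_ne_zero

/-- If the Jordan defect vanishes at `(p, p)`, `(q, q)` and `(p + q, p + q)`, then it vanishes at
`(p, q)`. -/
theorem jordanDefect_eq_zero_of_add {Δ : A →ₗ[ℂ] A} {p q : A} (hp : jordanDefect Δ p p = 0)
    (hq : jordanDefect Δ q q = 0) (hpq : jordanDefect Δ (p + q) (p + q) = 0) :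
    jordanDefect Δ p q = 0 := by
  simp only [map_add, LinearMap.add_apply, hp, hq, jordanDefect_comm Δ q p, zero_add,
    add_zero] at hpq
  exact eq_zero_of_add_self_eq_zero hpq

theorem jordanDefect_self_of_isIdempotentElem {Δ : A →ₗ[ℂ] A} {p : A} (hp : IsIdempotentElem p)
    (h : Δ p = Δ p * p + p * Δ p) : jordanDefect Δ p p = 0 := by
  rw [jordanDefect_apply, hp.eq, map_add, add_assoc, ← h, sub_self]

end JordanDefect

/-! ### Jordan identity on rank-one operators -/

section RankOne

variable {H : Type*} [NormedAddCommGroup H] [InnerProductSpace ℂ H]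

theorem rankOne_mul_rankOne (u v x y : H) :
    rankOne ℂ u v * rankOne ℂ x y = inner ℂ v x • rankOne ℂ u y := by
  ext z
  simp [rankOne_apply, smul_smul, mul_comm]

theorem rankOne_polarization (x y : H) :
    (4 : ℂ) • rankOne ℂ x y =
      rankOne ℂ (x + y) (x + y) - rankOne ℂ (x - y) (x - y)
        + Complex.I • rankOne ℂ (x + Complex.I • y) (x + Complex.I • y)
        - Complex.I • rankOne ℂ (x - Complex.I • y) (x - Complex.I • y) := by
  ext z
  simp only [rankOne_apply, FunLike.coe_smul, Pi.smul_apply, _root_.add_apply,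
    _root_.sub_apply, inner_add_left, inner_sub_left, inner_smul_left,
    Complex.conj_I]
  match_scalars <;> ring_nf <;> simp <;> ring

theorem rankOne_smul_self (c : ℂ) (x : H) :
    rankOne ℂ (c • x) (c • x) = ((‖c‖ : ℂ) ^ 2) • rankOne ℂ x x := by
  ext z
  simp only [rankOne_apply, FunLike.coe_smul, Pi.smul_apply, inner_smul_left, smul_smul]
  rw [← Complex.conj_mul']
  congr 1
  ring

variable [CompleteSpace H] {Δ : (H →L[ℂ] H) →ₗ[ℂ] (H →L[ℂ] H)}

theorem jordanDefect_rankOne_self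
    (hproj : ∀ p : H →L[ℂ] H, IsStarProjection p → jordanDefect Δ p p = 0) (x : H) :
    jordanDefect Δ (rankOne ℂ x x) (rankOne ℂ x x) = 0 := by
  rcases eq_or_ne x 0 with rfl | hx
  · simp
  · have hx' : ‖x‖ ≠ 0 := norm_ne_zero_iff.mpr hx
    have h := hproj _ (isStarProjection_rankOne_self (𝕜 := ℂ)
      (x := ((‖x‖⁻¹ : ℝ) : ℂ) • x) (by simp [norm_smul, hx']))
    rw [rankOne_smul_self] at h
    simpa [hx'] using h

/-- After normalization the two operators are orthogonal projections, so their sum is again a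
projection. -/
theorem jordanDefect_rankOne_of_orthogonal
    (hproj : ∀ p : H →L[ℂ] H, IsStarProjection p → jordanDefect Δ p p = 0) {x y : H}
    (hxy : inner ℂ x y = 0) : jordanDefect Δ (rankOne ℂ x x) (rankOne ℂ y y) = 0 := by
  rcases eq_or_ne x 0 with rfl | hx
  · simp
  rcases eq_or_ne y 0 with rfl | hy
  · simp
  have hx' : ‖x‖ ≠ 0 := norm_ne_zero_iff.mpr hx
  have hy' : ‖y‖ ≠ 0 := norm_ne_zero_iff.mpr hy
  have h1 := isStarProjection_rankOne_self (𝕜 := ℂ)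
      (x := ((‖x‖⁻¹ : ℝ) : ℂ) • x) (by simp [norm_smul, hx'])
  have h2 := isStarProjection_rankOne_self (𝕜 := ℂ)
      (x := ((‖y‖⁻¹ : ℝ) : ℂ) • y) (by simp [norm_smul, hy'])
  have h3 := h1.add h2 (by
    rw [rankOne_mul_rankOne, inner_smul_left, inner_smul_right, hxy]; simp)
  have h := jordanDefect_eq_zero_of_add (hproj _ h1) (hproj _ h2) (hproj _ h3)
  rw [rankOne_smul_self, rankOne_smul_self] at h
  simpa [hx', hy'] using h

/-- The hypotheses make `x + y` and `x - y` orthogonal, so the sum of the two operators is rewritten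
by an orthogonal pair, to which the previous case applies. -/
theorem jordanDefect_rankOne_of_norm_eq
    (hproj : ∀ p : H →L[ℂ] H, IsStarProjection p → jordanDefect Δ p p = 0) {x y : H}
    (hnorm : ‖x‖ = ‖y‖) (hxy : inner ℂ x y = inner ℂ y x) :
    jordanDefect Δ (rankOne ℂ x x) (rankOne ℂ y y) = 0 := by
  have key : rankOne ℂ x x + rankOne ℂ y y = (2⁻¹ : ℂ) •
      (rankOne ℂ (x + y) (x + y) + rankOne ℂ (x - y) (x - y)) := by
    simp only [map_add, map_sub, _root_.add_apply, _root_.sub_apply]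
    module
  have horth : inner ℂ (x + y) (x - y) = 0 := by
    simp only [inner_add_left, inner_sub_right, inner_self_eq_norm_sq_to_K, hnorm, hxy]
    ring
  refine jordanDefect_eq_zero_of_add (jordanDefect_rankOne_self hproj x)
    (jordanDefect_rankOne_self hproj y) ?_
  have h1 := jordanDefect_rankOne_of_orthogonal hproj horth
  have h2 := h1
  rw [jordanDefect_comm] at h2
  rw [key]
  simp only [map_smul, LinearMap.smul_apply]
  have h3 := jordanDefect_rankOne_self hproj (x + y)
  have h4 := jordanDefect_rankOne_self hproj (x - y)
  generalize rankOne ℂ (x + y) (x + y) = p at *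
  generalize rankOne ℂ (x - y) (x - y) = q at *
  simp [h1, h2, h3, h4]

theorem jordanDefect_rankOne_self_self
    (hproj : ∀ p : H →L[ℂ] H, IsStarProjection p → jordanDefect Δ p p = 0) (x y : H) :
    jordanDefect Δ (rankOne ℂ x x) (rankOne ℂ y y) = 0 := by
  rcases eq_or_ne (inner ℂ x y) 0 with h0 | h0
  · exact jordanDefect_rankOne_of_orthogonal hproj h0
  have hx : ‖x‖ ≠ 0 := by rintro h; simp [norm_eq_zero.mp h] at h0
  have hy : ‖y‖ ≠ 0 := by rintro h; simp [norm_eq_zero.mp h] at h0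
  have h0' : ‖(inner ℂ x y : ℂ)‖ ≠ 0 := norm_ne_zero_iff.mpr h0
  -- The phase makes `⟪x, c • y⟫` real; the modulus makes `‖c • y‖ = ‖x‖`.
  set c : ℂ := ((‖x‖ / ‖y‖ / ‖(inner ℂ x y : ℂ)‖ : ℝ) : ℂ) * star (inner ℂ x y : ℂ) with hc
  have hcn : ‖c‖ = ‖x‖ / ‖y‖ := by
    rw [hc, norm_mul, Complex.norm_real, norm_star, Real.norm_of_nonneg (by positivity)]
    field_simp
  have hcx : inner ℂ x (c • y) = inner ℂ (c • y) x := by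
    rw [inner_smul_right, inner_smul_left, hc, ← inner_conj_symm y x]
    simp
    ring
  have h := jordanDefect_rankOne_of_norm_eq hproj (x := x) (y := c • y)
    (by rw [norm_smul, hcn]; field_simp) hcx
  rw [rankOne_smul_self, hcn] at h
  simpa [hx, hy] using h

theorem jordanDefect_rankOne
    (hproj : ∀ p : H →L[ℂ] H, IsStarProjection p → jordanDefect Δ p p = 0) (u v x y : H) :
    jordanDefect Δ (rankOne ℂ u v) (rankOne ℂ x y) = 0 := by
  have h : jordanDefect Δ ((4 : ℂ) • rankOne ℂ u v) ((4 : ℂ) • rankOne ℂ x y) = 0 := by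
    rw [rankOne_polarization u v, rankOne_polarization x y]
    simp only [map_add (jordanDefect Δ), map_sub (jordanDefect Δ), map_smul (jordanDefect Δ),
      LinearMap.add_apply, LinearMap.sub_apply, LinearMap.smul_apply,
      map_add (jordanDefect Δ (rankOne ℂ _ _)), map_sub (jordanDefect Δ (rankOne ℂ _ _)),
      map_smul (jordanDefect Δ (rankOne ℂ _ _)),
      jordanDefect_rankOne_self_self hproj, smul_zero, sub_zero, add_zero]
  simpa using h

/-- A *-preserving linear map satisfying the Jordan identity at all projections and vanishing at a
rank-one projection is implemented, on rank-one operators, by a skew-adjoint operator. -/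
theorem exists_skew_forall_rankOne (hproj : ∀ p : H →L[ℂ] H, IsStarProjection p →
      jordanDefect Δ p p = 0)
    (hstar : ∀ x, Δ (star x) = star (Δ x)) {e : H} (he : ‖e‖ = 1)
    (hΔe : Δ (rankOne ℂ e e) = 0) :
    ∃ a : H →L[ℂ] H, star a = -a ∧
      ∀ x y, Δ (rankOne ℂ x y) = a * rankOne ℂ x y - rankOne ℂ x y * a := by
  have hee : inner ℂ e e = (1 : ℂ) := by rw [inner_self_eq_norm_sq_to_K, he]; simp
  set g : H →ₗ[ℂ] H :=
    { toFun := fun x => Δ (rankOne ℂ x e) e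
      map_add' := fun x y => by simp
      map_smul' := fun c x => by simp } with hg
  have hstarR (x y : H) : star (rankOne ℂ x y) = rankOne ℂ y x := by
    rw [star_eq_adjoint, adjoint_rankOne]
  have horth (x : H) (hx : inner ℂ e x = 0) :
      Δ (rankOne ℂ x e) = rankOne ℂ (g x) e ∧ inner ℂ e (g x) = 0 := by
    -- With `S = Δ (rankOne ℂ x e)` and `p = rankOne ℂ e e`, these give `S = p * S + S * p` and,
    -- since `rankOne ℂ x e` squares to zero, that `S` anticommutes with it.
    have h1 := jordanDefect_rankOne hproj e e x e
    have h2 := jordanDefect_rankOne hproj x e x e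
    rw [jordanDefect_apply, rankOne_mul_rankOne, rankOne_mul_rankOne, hx, hee, hΔe] at h1
    rw [jordanDefect_apply, rankOne_mul_rankOne, hx] at h2
    simp only [zero_smul, zero_add, one_smul, zero_mul, mul_zero, add_zero, map_zero,
      zero_sub, neg_eq_zero] at h1 h2
    set S := Δ (rankOne ℂ x e)
    have h2' : S * rankOne ℂ x e + rankOne ℂ x e * S = 0 := by
      apply eq_zero_of_add_self_eq_zero
      rw [← h2]; abel
    have e1 (z : H) : S z = inner ℂ e (S z) • e + inner ℂ e z • S e := by
      have := congrArg (fun T : H →L[ℂ] H => T z) (sub_eq_zero.mp h1)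
      simpa using this
    have e2 (z : H) : inner ℂ e z • S x + inner ℂ e (S z) • x = 0 := by
      have := congrArg (fun T : H →L[ℂ] H => T z) h2'
      simpa using this
    have e3 : inner ℂ e (S e) = 0 := by
      have := congrArg (inner ℂ e) (e1 e)
      rw [inner_add_right, inner_smul_right, inner_smul_right, hee] at this
      linear_combination -this
    refine ⟨?_, e3⟩
    have e4 : S x = 0 := by
      have := e2 e
      rwa [hee, e3, one_smul, zero_smul, add_zero] at this
    rcases eq_or_ne x 0 with rfl | hx0
    · simp [S, hg]
    ext z
    have e5 : inner ℂ e (S z) = 0 := by simpa [e4, hx0] using e2 z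
    rw [e1 z, e5]
    simp [hg, S]
  have hge : g e = 0 := by simp [hg, hΔe]
  have hcol (x : H) : Δ (rankOne ℂ x e) = rankOne ℂ (g x) e ∧ inner ℂ e (g x) = 0 := by
    obtain ⟨h1, h2⟩ := horth (x - inner ℂ e x • e)
      (by rw [inner_sub_right, inner_smul_right, hee]; ring)
    simp only [map_sub, map_smul, hge, smul_zero, sub_zero, _root_.sub_apply,
      FunLike.coe_smul, Pi.smul_apply, hΔe] at h1 h2
    exact ⟨h1, h2⟩
  have hrow (x : H) : Δ (rankOne ℂ e x) = rankOne ℂ e (g x) := by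
    rw [← hstarR, hstar, (hcol x).1, hstarR]
  have hgen (x y : H) : Δ (rankOne ℂ x y) = rankOne ℂ (g x) y + rankOne ℂ x (g y)
      + (inner ℂ (g y) x + inner ℂ y (g x)) • rankOne ℂ e e := by
    -- The product in one order is `rankOne ℂ x y`; in the other it is a multiple of `rankOne ℂ e
    -- e`, which `Δ` kills.
    have h := jordanDefect_rankOne hproj x e e y
    rw [jordanDefect_apply, (hcol x).1, hrow, sub_eq_zero] at h
    simp only [rankOne_mul_rankOne, hee, map_add, map_smul, hΔe, one_smul, smul_zero,
      add_zero] at h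
    rw [h]
    module
  have hskew (x y : H) : inner ℂ (g y) x + inner ℂ y (g x) = 0 := by
    have h := jordanDefect_rankOne hproj e e x y
    rw [jordanDefect_apply, rankOne_mul_rankOne, rankOne_mul_rankOne, map_add, map_smul, map_smul,
      (hcol x).1, hrow, hΔe, hgen x y, sub_eq_zero] at h
    -- In the `(e, e)` entry everything vanishes except twice the desired sum.
    have h' := congrArg (fun T : H →L[ℂ] H => inner ℂ e (T e)) h
    have h1 := (hcol x).2
    have h2 : inner ℂ (g y) e = 0 := by rw [← inner_conj_symm, (hcol y).2, map_zero]
    simp [inner_add_right, inner_smul_right, he, h1, h2] at h'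
    apply eq_zero_of_add_self_eq_zero
    linear_combination -h'
  -- Multiplying by `I` turns skew-symmetry into symmetry, so Hellinger–Toeplitz yields continuity.
  have hsymm : (Complex.I • g).IsSymmetric := fun x y => by
    have := hskew y x
    simp only [LinearMap.smul_apply, inner_smul_left, inner_smul_right, Complex.conj_I]
    linear_combination -Complex.I * this
  have hcont : Continuous g := by
    have h := hsymm.continuous.const_smul (-Complex.I)
    refine h.congr fun x => ?_
    simp [smul_smul]
  set a : H →L[ℂ] H := ⟨g, hcont⟩ with ha
  have hadj : adjoint a = -a := by
    symm
    rw [eq_adjoint_iff]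
    intro x y
    have := hskew y x
    simp only [_root_.neg_apply, inner_neg_left]
    change -inner ℂ (g x) y = inner ℂ x (g y)
    linear_combination -this
  refine ⟨a, by rw [star_eq_adjoint, hadj], fun x y => ?_⟩
  have h1 : a * rankOne ℂ x y = rankOne ℂ (g x) y := by
    ext z; simp [ha]
  have h2 : rankOne ℂ x y * a = -rankOne ℂ x (g y) := by
    change rankOne ℂ x y ∘L a = _
    rw [rankOne_comp, hadj]
    simp [ha]
  rw [hgen, hskew, h1, h2]
  simp

end RankOne

end

/-! ### Finite-rank compressions -/

noncomputable section

open InnerProductSpace ContinuousLinearMap Filter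

variable {H : Type*} [NormedAddCommGroup H] [InnerProductSpace ℂ H]

/-- The compression of an operator to the span of a finite set. -/
def compression (s : Finset H) (T : H →L[ℂ] H) : H →L[ℂ] H :=
  (Submodule.span ℂ (s : Set H)).starProjection * T *
    (Submodule.span ℂ (s : Set H)).starProjection

theorem compression_eq_sum_rankOne (s : Finset H) (T : H →L[ℂ] H) :
    ∃ (n : ℕ) (x y : Fin n → H), compression s T = ∑ i, rankOne ℂ (x i) (y i) := by
  set U := Submodule.span ℂ (s : Set H)
  set b := stdOrthonormalBasis ℂ U
  refine ⟨_, fun i => U.starProjection (T (b i)), fun i => b i, ?_⟩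
  unfold compression
  conv_lhs => rw [b.starProjection_eq_sum_rankOne]
  rw [Finset.mul_sum]
  refine Finset.sum_congr rfl fun i _ => ?_
  rw [← b.starProjection_eq_sum_rankOne]
  ext z
  simp [U]

theorem tendsto_starProjection_span_finset (x : H) :
    Tendsto (fun s : Finset H => (Submodule.span ℂ (s : Set H)).starProjection x) atTop (𝓝 x) := by
  refine Submodule.starProjection_tendsto_self _
    (fun s t h => Submodule.span_mono (Finset.coe_subset.mpr h)) x ?_
  refine le_trans (fun y _ => ?_) (Submodule.le_topologicalClosure _)
  exact Submodule.mem_iSup_of_mem {y} (Submodule.subset_span (by simp))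

theorem norm_compression_apply_le (s : Finset H) (T : H →L[ℂ] H) (x : H) :
    ‖compression s T x‖ ≤ ‖T‖ * ‖x‖ := by
  have hP (y : H) : ‖(Submodule.span ℂ (s : Set H)).starProjection y‖ ≤ ‖y‖ :=
    Submodule.norm_starProjection_apply_le _ _
  calc ‖compression s T x‖ ≤ ‖T ((Submodule.span ℂ (s : Set H)).starProjection x)‖ := hP _
    _ ≤ ‖T‖ * ‖(Submodule.span ℂ (s : Set H)).starProjection x‖ := T.le_opNorm _
    _ ≤ ‖T‖ * ‖x‖ := by gcongr; exact hP x

theorem tendsto_compression_apply (T : H →L[ℂ] H) (x : H) :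
    Tendsto (fun s : Finset H => compression s T x) atTop (𝓝 (T x)) := by
  have h1 : Tendsto (fun s : Finset H =>
      (Submodule.span ℂ (s : Set H)).starProjection
        (T ((Submodule.span ℂ (s : Set H)).starProjection x - x))) atTop (𝓝 0) := by
    refine squeeze_zero_norm (fun s => Submodule.norm_starProjection_apply_le _ _) ?_
    have h := (T.continuous.tendsto _).comp
      ((tendsto_starProjection_span_finset x).sub_const x)
    simpa using h.norm
  have h := h1.add (tendsto_starProjection_span_finset (T x))
  rw [zero_add] at h
  refine h.congr fun s => ?_
  rw [map_sub, map_sub, sub_add_cancel]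
  rfl

variable [CompleteSpace H]

/-! ### Complexification -/

theorem star_coe_skewAdjointOperators (a : skewAdjointOperators H) :
    star (a : H →L[ℂ] H) = -a := a.2

theorem coe_lie_skewAdjointOperators (a b : skewAdjointOperators H) :
    ((⁅a, b⁆ : skewAdjointOperators H) : H →L[ℂ] H) = a * b - b * a := rfl

theorem coe_smul_skewAdjointOperators (c : ℝ) (a : skewAdjointOperators H) :
    ((c • a : skewAdjointOperators H) : H →L[ℂ] H) = c • (a : H →L[ℂ] H) := rfl

variable (H) in
/-- The real-linear projection of the bounded operators onto the skew-adjoint ones. -/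
def skewPart : (H →L[ℂ] H) →ₗ[ℝ] skewAdjointOperators H where
  toFun x := ⟨(2⁻¹ : ℝ) • (x - star x), by
    change star ((2⁻¹ : ℝ) • (x - star x)) = -((2⁻¹ : ℝ) • (x - star x))
    rw [star_smul, star_sub, star_star, star_trivial, ← smul_neg, neg_sub]⟩
  map_add' x y := Subtype.ext <| by
    change (2⁻¹ : ℝ) • (x + y - star (x + y)) =
      (2⁻¹ : ℝ) • (x - star x) + (2⁻¹ : ℝ) • (y - star y)
    rw [star_add]
    module
  map_smul' c x := Subtype.ext <| by
    change (2⁻¹ : ℝ) • (c • x - star (c • x)) = c • (2⁻¹ : ℝ) • (x - star x)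
    rw [star_smul, star_trivial]
    module

theorem skewPart_coe (a : skewAdjointOperators H) : skewPart H a = a := by
  refine Subtype.ext ?_
  change (2⁻¹ : ℝ) • ((a : H →L[ℂ] H) - star (a : H →L[ℂ] H)) = a
  rw [star_coe_skewAdjointOperators]
  module

theorem skewPart_star (x : H →L[ℂ] H) : skewPart H (star x) = -skewPart H x := by
  refine Subtype.ext ?_
  change (2⁻¹ : ℝ) • (star x - star (star x)) = -((2⁻¹ : ℝ) • (x - star x))
  rw [star_star]
  module

theorem skewPart_of_isSelfAdjoint {x : H →L[ℂ] H} (hx : IsSelfAdjoint x) : skewPart H x = 0 := by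
  refine Subtype.ext ?_
  change (2⁻¹ : ℝ) • (x - star x) = 0
  rw [hx.star_eq, sub_self, smul_zero]

theorem skewPart_I_smul_coe (a : skewAdjointOperators H) :
    skewPart H (Complex.I • (a : H →L[ℂ] H)) = 0 := by
  refine skewPart_of_isSelfAdjoint ?_
  rw [IsSelfAdjoint, star_smul, star_coe_skewAdjointOperators]
  simp

/-- The complex-linear extension to all bounded operators of a real-linear map on the skew-adjoint
operators. -/
def complexification (D : skewAdjointOperators H →ₗ[ℝ] skewAdjointOperators H) :
    (H →L[ℂ] H) →ₗ[ℂ] (H →L[ℂ] H) where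
  -- Comes from `x = skewPart x - I • skewPart (I • x)`.
  toFun x := D (skewPart H x) - Complex.I • (D (skewPart H (Complex.I • x)) : H →L[ℂ] H)
  map_add' x y := by
    simp only [smul_add, map_add, AddMemClass.coe_add]
    abel
  map_smul' c x := by
    have h1 : c • x = c.re • x + c.im • Complex.I • x := by
      conv_lhs => rw [← Complex.re_add_im c]
      rw [add_smul, mul_smul]
      rfl
    have h2 : Complex.I • c • x = c.re • Complex.I • x - c.im • x := by
      rw [h1, smul_add, smul_comm _ c.re, smul_comm _ c.im, smul_smul Complex.I Complex.I,
        Complex.I_mul_I]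
      module
    rw [h2, h1]
    simp only [map_add, map_sub, map_smul, AddMemClass.coe_add, AddSubgroupClass.coe_sub,
      coe_smul_skewAdjointOperators, RingHom.id_apply]
    conv_rhs => rw [← Complex.re_add_im c]
    simp only [← Complex.coe_smul]
    match_scalars <;> ring_nf <;> simp

theorem complexification_apply (D : skewAdjointOperators H →ₗ[ℝ] skewAdjointOperators H)
    (x : H →L[ℂ] H) : complexification D x =
      D (skewPart H x) - Complex.I • (D (skewPart H (Complex.I • x)) : H →L[ℂ] H) := rfl

theorem complexification_coe (D : skewAdjointOperators H →ₗ[ℝ] skewAdjointOperators H)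
    (a : skewAdjointOperators H) : complexification D a = D a := by
  rw [complexification_apply, skewPart_coe, skewPart_I_smul_coe]
  simp

theorem complexification_star (D : skewAdjointOperators H →ₗ[ℝ] skewAdjointOperators H)
    (x : H →L[ℂ] H) : complexification D (star x) = star (complexification D x) := by
  have h : Complex.I • star x = -star (Complex.I • x) := by simp
  rw [complexification_apply, complexification_apply, h, map_neg, skewPart_star, skewPart_star,
    star_sub, star_smul, star_coe_skewAdjointOperators, star_coe_skewAdjointOperators]
  simp only [map_neg, NegMemClass.coe_neg, neg_neg, Complex.star_def, Complex.conj_I]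
  module

/-- On self-adjoint operators, the complexification of a local inner derivation is pointwise
a commutator. -/
theorem IsLocalInnerDerivation.exists_complexification_eq
    {D : skewAdjointOperators H →ₗ[ℝ] skewAdjointOperators H} (hD : IsLocalInnerDerivation D)
    {p : H →L[ℂ] H} (hp : IsSelfAdjoint p) :
    ∃ b : skewAdjointOperators H, complexification D p = b * p - p * b := by
  have hskew : star (Complex.I • p) = -(Complex.I • p) := by
    rw [star_smul, hp.star_eq]; simp
  obtain ⟨E, ⟨b, hb⟩, hE⟩ := hD ⟨Complex.I • p, hskew⟩
  refine ⟨b, ?_⟩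
  have h : complexification D (Complex.I • p) = b * (Complex.I • p) - (Complex.I • p) * b := by
    have := complexification_coe D ⟨Complex.I • p, hskew⟩
    rwa [hE, hb, coe_lie_skewAdjointOperators] at this
  rw [map_smul, mul_smul_comm, smul_mul_assoc, ← smul_sub] at h
  exact smul_right_injective _ Complex.I_ne_zero h

/-- A local inner derivation is given by a single commutator on rank-one operators. -/
theorem IsLocalInnerDerivation.exists_forall_rankOne
    {D : skewAdjointOperators H →ₗ[ℝ] skewAdjointOperators H} (hD : IsLocalInnerDerivation D) :
    ∃ a : skewAdjointOperators H, ∀ x y : H, complexification D (rankOne ℂ x y) =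
      a * rankOne ℂ x y - rankOne ℂ x y * a := by
  rcases subsingleton_or_nontrivial H with hH | hH
  · exact ⟨0, fun x y => by ext z; exact Subsingleton.elim _ _⟩
  obtain ⟨e, he⟩ := exists_norm_eq H zero_le_one
  obtain ⟨b, hb⟩ := hD.exists_complexification_eq
    (isStarProjection_rankOne_self (𝕜 := ℂ) he).isSelfAdjoint
  -- Subtracting the commutator with `b` kills the projection onto `e` and keeps the Leibniz rule at
  -- projections.
  set Δ : (H →L[ℂ] H) →ₗ[ℂ] (H →L[ℂ] H) := complexification D -
    (LinearMap.mulLeft ℂ (b : H →L[ℂ] H) - LinearMap.mulRight ℂ (b : H →L[ℂ] H)) with hΔ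
  have hΔ' (x : H →L[ℂ] H) : Δ x = complexification D x - (b * x - x * b) := rfl
  obtain ⟨a, ha, h⟩ := exists_skew_forall_rankOne (Δ := Δ)
    (fun p hp => by
      obtain ⟨c, hc⟩ := hD.exists_complexification_eq hp.isSelfAdjoint
      refine jordanDefect_self_of_isIdempotentElem hp.isIdempotentElem ?_
      have hpp := hp.isIdempotentElem.eq
      have hp' (x : H →L[ℂ] H) : p * (p * x) = p * x := by rw [← mul_assoc, hpp]
      rw [hΔ', hc]
      simp only [sub_mul, mul_sub, mul_assoc, hpp, hp']
      abel)
    (fun x => by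
      rw [hΔ', hΔ', complexification_star]
      simp only [star_sub, star_mul, star_coe_skewAdjointOperators]
      noncomm_ring)
    he (by rw [hΔ', hb, sub_self])
  refine ⟨⟨a, ha⟩ + b, fun x y => ?_⟩
  have h' := h x y
  rw [hΔ', sub_eq_iff_eq_add] at h'
  rw [h', AddMemClass.coe_add]
  noncomm_ring

/-! ### Ultraweak approximation -/

theorem star_compression (s : Finset H) (T : skewAdjointOperators H) :
    star (compression s (T : H →L[ℂ] H)) = -compression s (T : H →L[ℂ] H) := by
  simp only [compression, star_mul, (isSelfAdjoint_starProjection _).star_eq,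
    star_coe_skewAdjointOperators]
  noncomm_ring

/-- Each term converges by strong convergence, and `‖T‖` bounds all compressions, so dominated
convergence for series applies. -/
theorem tendsto_skewUltraweak_compression (T : skewAdjointOperators H) :
    Tendsto (fun s : Finset H => (⟨compression s T, star_compression s T⟩ : skewAdjointOperators H))
      atTop (@nhds _ (skewUltraweakTopology H) T) := by
  simp only [nhds_induced, nhds_iInf, tendsto_comap_iff, tendsto_iInf]
  intro x y hx hy
  have hbound : Summable fun n => ‖T.1‖ * (‖x n‖ ^ 2 + ‖y n‖ ^ 2) := (hx.add hy).mul_left _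
  refine tendsto_tsum_of_dominated_convergence hbound (fun n => ?_)
    (Eventually.of_forall fun s n => ?_)
  · exact tendsto_const_nhds.inner (tendsto_compression_apply T.1 (x n))
  · have h1 : ‖(inner ℂ (y n) (compression s T.1 (x n)) : ℂ)‖ ≤ ‖y n‖ * (‖T.1‖ * ‖x n‖) :=
      (norm_inner_le_norm _ _).trans (by gcongr; exact norm_compression_apply_le s T.1 (x n))
    refine h1.trans ?_
    rw [mul_left_comm]
    gcongr
    nlinarith [sq_nonneg (‖x n‖ - ‖y n‖), sq_nonneg ‖x n‖, sq_nonneg ‖y n‖]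

/-- Matrix coefficients are the series functionals of sequences supported at index `0`; they
separate operators in the final limit argument. -/
theorem continuous_skewUltraweak_inner (x y : H) :
    Continuous[skewUltraweakTopology H, inferInstance]
      fun T : skewAdjointOperators H => inner ℂ y ((T : H →L[ℂ] H) x) := by
  have hs (z : H) : Summable fun n => ‖(Pi.single 0 z : ℕ → H) n‖ ^ 2 :=
    summable_of_ne_finset_zero (s := {0}) fun n hn => by
      rw [Pi.single_eq_of_ne (by simpa using hn)]; simp
  have h : Continuous[ultraweakTopology H, inferInstance]
      (vectorSeriesFunctional (Pi.single 0 x : ℕ → H) (Pi.single 0 y)) := by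
    rw [continuous_iff_le_induced]
    exact iInf_le_of_le _ (iInf_le_of_le _ (iInf_le_of_le (hs x) (iInf_le _ (hs y))))
  have heq (a : H →L[ℂ] H) : vectorSeriesFunctional (Pi.single 0 x : ℕ → H) (Pi.single 0 y) a =
      inner ℂ y (a x) := by
    unfold vectorSeriesFunctional
    rw [tsum_eq_single 0 fun n hn => by simp [Pi.single_eq_of_ne hn]]
    simp
  have h' := @Continuous.comp _ _ _ (skewUltraweakTopology H) (ultraweakTopology H) _ _ _ h
    continuous_induced_dom
  exact (funext fun T : skewAdjointOperators H => heq T) ▸ h'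

end

theorem mainTheorem3 {H : Type*} [NormedAddCommGroup H] [InnerProductSpace ℂ H] [CompleteSpace H]
    [TopologicalSpace.SeparableSpace H]
    (D : skewAdjointOperators H →ₗ[ℝ] skewAdjointOperators H)
    (hD : IsLocalInnerDerivation D)
    (hcont : Continuous[skewUltraweakTopology H, skewUltraweakTopology H] D) :
    IsInnerDerivation D := by
  obtain ⟨a, ha⟩ := hD.exists_forall_rankOne
  refine ⟨a, fun T => Subtype.ext (ContinuousLinearMap.ext fun x => ext_inner_left ℂ fun y => ?_)⟩
  set F : Finset H → skewAdjointOperators H :=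
    fun s => ⟨compression s T, star_compression s T⟩ with hF
  have hDF (s : Finset H) : (D (F s) : H →L[ℂ] H) = a * compression s T - compression s T * a := by
    rw [← complexification_coe]
    change complexification D (compression s T) = _
    obtain ⟨n, u, v, huv⟩ := compression_eq_sum_rankOne s (T : H →L[ℂ] H)
    simp only [huv, map_sum, ha, Finset.sum_sub_distrib, Finset.mul_sum, Finset.sum_mul]
  have h1 : Filter.Tendsto (fun s => inner ℂ y ((D (F s) : H →L[ℂ] H) x)) Filter.atTop
      (𝓝 (inner ℂ y ((D T : H →L[ℂ] H) x))) := by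
    let _ := skewUltraweakTopology H
    exact (((continuous_skewUltraweak_inner x y).comp hcont).tendsto T).comp
      (tendsto_skewUltraweak_compression T)
  -- The same coefficients also converge to those of `⁅a, T⁆`, by strong convergence of the
  -- compressions.
  refine tendsto_nhds_unique h1 ?_
  simp only [hDF, coe_lie_skewAdjointOperators]
  exact tendsto_const_nhds.inner
    (((a.1.continuous.tendsto _).comp (tendsto_compression_apply T.1 x)).sub
      (tendsto_compression_apply T.1 (a.1 x)))
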